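/- Let $\Omega$ be a countably infinite set and let $G\leq\mathrm{Sym}(\Omega)$ be a subgroup that is closed for the topology of pointwise convergence; equip $G$ with the induced topology. For $A\subseteq\Omega$ let $G_A=\{g\in G: g(a)=a \text{ for all } a\in A\}$ be the pointwise stabilizer and $G_{\{A\}}=\{g\in G: g(A)=A\}$ the setwise stabilizer; write $G_a=G_{\{a\}}$ for the stabilizer of a point $a\in\Omega$. A unitary representation of $G$ is a homomorphism $\pi\colon G\to\mathcal U(\mathcal H)$, where $\mathcal H$ is a complex Hilbert space, that is continuous for the strong operator topology. The group $G$ is *dissociated* if for every unitary representation $\pi\colon G\to\mathcal U(\mathcal H)$ and all finite $A,B\subseteq\Omega$ we have $p_Ap_B=p_{A\cap B}$, where $p_A$ is the orthogonal projection onto the space of $\pi(G_A)$-invariant vectors. A *group bornology* on $G$ is a collection $\mathcal B$ of subsets of $G$, called bounded sets, that contains all singletons and is closed under taking subsets, inverses $A^{-1}$, finite unions and products $AB$. A subset of $G$ is *coarsely bounded* if it has finite diameter for every continuous left-invariant pseudometric on $G$. Given a group bornology $\mathcal B$, the pair $(G,\mathcal B)$ has the *Howe–Moore property* if for every unitary representation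 $\pi$ of $G$ on $\mathcal H$ without non-zero invariant vector and all $\xi,\eta\in\mathcal H$, the function $f(g)=\langle\pi(g)\xi\mid\eta\rangle$ is continuous and vanishes at infinity, that is, for every $\varepsilon>0$ there is $B\in\mathcal B$ such that $|f(g)|<\varepsilon$ for all $g\in G\setminus B$. **Theorem.** Let $G\leq\mathrm{Sym}(\Omega)$ be a closed permutation group that acts on $\Omega$ without fixed points, and let $\mathcal B$ be a group bornology on $G$ all of whose members are coarsely bounded. If $G$ is dissociated, then the following are equivalent: 1. $(G,\mathcal B)$ has the Howe–Moore property; 2. every proper open subgroup of $G$ is bounded; 3. for every non-empty finite $A\subseteq\Omega$, the setwise stabilizer $G_{\{A\}}$ is bounded; 4. for every non-empty finite $A\subseteq\Omega$, the pointwise stabilizer $G_A$ is bounded; 5. for every $a\in\Omega$, the point stabilizer $G_a$ is bounded. -/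

import Mathlib

open scoped Pointwise

universe u v

namespace HoweMoore

/-- The topology of pointwise convergence on `Sym(Ω)`, where `Ω` is discrete: the topology induced
by the inclusion of `Sym(Ω)` in `Ω → Ω`. -/
instance permTopology {Ω : Type u} : TopologicalSpace (Equiv.Perm Ω) :=
  TopologicalSpace.induced (fun (σ : Equiv.Perm Ω) (x : Ω) => σ x)
    (@Pi.topologicalSpace Ω (fun _ => Ω) (fun _ => ⊥))

section Representations

/-- A unitary representation of a topological group `G` on `H`: a homomorphism to the unitary group
of `H` which is continuous for the strong operator topology. -/
structure UnitaryRep (G : Type u) [Group G] [TopologicalSpace G]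
    (H : Type v) [NormedAddCommGroup H] [InnerProductSpace ℂ H] where
  toHom : G →* (H ≃ₗᵢ[ℂ] H)
  continuous_orbit : ∀ ξ : H, Continuous fun g : G => toHom g ξ

variable {G : Type u} [Group G] [TopologicalSpace G]
  {H : Type v} [NormedAddCommGroup H] [InnerProductSpace ℂ H]

/-- The subspace of vectors that are invariant under a subgroup `K`. -/
def UnitaryRep.invariants (π : UnitaryRep G H) (K : Subgroup G) : Submodule ℂ H where
  carrier := {ξ | ∀ g ∈ K, π.toHom g ξ = ξ}
  add_mem' := fun ha hb g hg => by rw [map_add, ha g hg, hb g hg]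
  zero_mem' := fun g _ => map_zero _
  smul_mem' := fun c x hx g hg => by rw [map_smul, hx g hg]

theorem UnitaryRep.isClosed_invariants (π : UnitaryRep G H) (K : Subgroup G) :
    IsClosed (π.invariants K : Set H) := by
  have h : (π.invariants K : Set H) = ⋂ g ∈ K, {ξ | π.toHom g ξ = ξ} := by
    ext ξ
    simp only [Set.mem_iInter, Set.mem_ofPred_eq]
    rfl
  rw [h]
  exact isClosed_biInter fun g _ =>
    isClosed_eq (π.toHom g).continuous continuous_id

instance UnitaryRep.completeSpace_invariants [CompleteSpace H] (π : UnitaryRep G H)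
    (K : Subgroup G) : CompleteSpace (π.invariants K) :=
  (π.isClosed_invariants K).completeSpace_coe

end Representations

section Dissociation

variable {Ω : Type u} {G : Subgroup (Equiv.Perm Ω)}

/-- A unitary representation of the permutation group `G` is dissociated if
`p_A p_B = p_{A ∩ B}` for all finite `A, B ⊆ Ω`, where `p_A` is the orthogonal projection onto the
vectors that are invariant under the pointwise stabilizer of `A`. -/
def UnitaryRep.IsDissociated {H : Type v} [NormedAddCommGroup H] [InnerProductSpace ℂ H]
    [CompleteSpace H] (π : UnitaryRep G H) : Prop :=
  ∀ A B : Set Ω, A.Finite → B.Finite →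
    (π.invariants (fixingSubgroup G A)).starProjection ∘L
        (π.invariants (fixingSubgroup G B)).starProjection =
      (π.invariants (fixingSubgroup G (A ∩ B))).starProjection

/-- A permutation group is dissociated if all its unitary representations (on complex Hilbert
spaces) are. -/
def IsDissociated (G : Subgroup (Equiv.Perm Ω)) : Prop :=
  ∀ (H : Type u) [NormedAddCommGroup H] [InnerProductSpace ℂ H] [CompleteSpace H]
    (π : UnitaryRep G H), π.IsDissociated

end Dissociation

section Bornology

/-- `d` is a pseudometric on `G` which is continuous and left-invariant. -/
structure IsContinuousLeftInvariantPseudometric {G : Type u} [Group G] [TopologicalSpace G]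
    (d : G → G → ℝ) : Prop where
  self_eq_zero : ∀ x, d x x = 0
  symm : ∀ x y, d x y = d y x
  triangle : ∀ x y z, d x z ≤ d x y + d y z
  continuous : Continuous fun p : G × G => d p.1 p.2
  left_invariant : ∀ g x y, d (g * x) (g * y) = d x y

/-- A set is coarsely bounded if it has finite diameter for every continuous left-invariant
pseudometric on the group. -/
def IsCoarselyBounded {G : Type u} [Group G] [TopologicalSpace G] (B : Set G) : Prop :=
  ∀ d : G → G → ℝ, IsContinuousLeftInvariantPseudometric d →
    ∃ C : ℝ, ∀ x ∈ B, ∀ y ∈ B, d x y ≤ C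

/-- The bornology of `G` is a group bornology. (That singletons, subsets and finite unions of
bounded sets are bounded is part of `Bornology`.) -/
structure IsGroupBornology (G : Type u) [Group G] [Bornology G] : Prop where
  inv : ∀ A : Set G, Bornology.IsBounded A → Bornology.IsBounded A⁻¹
  mul : ∀ A B : Set G, Bornology.IsBounded A → Bornology.IsBounded B →
    Bornology.IsBounded (A * B)

/-- The group `G` with its topology and its bornology is a topological bornological group: the
bornology is a group bornology all of whose bounded sets are coarsely bounded. -/
structure IsTopologicalBornologicalGroup (G : Type u) [Group G] [TopologicalSpace G]
    [Bornology G] : Prop where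
  isTopologicalGroup : IsTopologicalGroup G
  isGroupBornology : IsGroupBornology G
  isCoarselyBounded : ∀ B : Set G, Bornology.IsBounded B → IsCoarselyBounded B

/-- Membership in `C₀(G, 𝓑)`: continuous functions that vanish at infinity for the bornology. -/
def IsC0 {G : Type u} [TopologicalSpace G] [Bornology G] (f : G → ℂ) : Prop :=
  Continuous f ∧ ∀ ε : ℝ, 0 < ε →
    ∃ B : Set G, Bornology.IsBounded B ∧ ∀ g : G, g ∉ B → ‖f g‖ < ε

/-- The Howe–Moore property: every matrix coefficient of every unitary representation without
non-zero invariant vector belongs to `C₀(G, 𝓑)`. -/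
def HasHoweMoore (G : Type u) [Group G] [TopologicalSpace G] [Bornology G] : Prop :=
  ∀ (H : Type u) [NormedAddCommGroup H] [InnerProductSpace ℂ H] [CompleteSpace H]
    (π : UnitaryRep G H), (∀ ξ : H, (∀ g : G, π.toHom g ξ = ξ) → ξ = 0) →
      ∀ ξ η : H, IsC0 fun g : G => inner ℂ (π.toHom g ξ) η

end Bornology

end HoweMoore

/-! The implications run in the cycle 1 → 2 → 3 → 4 → 5 → 1; the substance lies in 5 → 1, 1 → 2 and
2 → 3.

For 5 → 1, continuity makes vectors fixed by some `G_A`, `A` finite, dense. If `ξ` is fixed by `G_A`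
and `η` by `G_B`, then `π(g)ξ` is fixed by `G_{gA}`; when `gA` misses `B`, dissociation and the
absence of invariant vectors give `⟨π(g)ξ, η⟩ = 0`. The exceptional `g` lie in finitely many cosets
of point stabilizers, a bounded set.

For 1 → 2, an open subgroup `U` fixes a point mass in `ℓ²(G/U)`. If `U` is proper, the component
orthogonal to the invariant vectors is non-zero and gives a coefficient that is a positive constant
on `U`.

For 2 → 3, `G_{{A}}` is open since it contains `G_A`; it is proper because dissociation on `ℓ²(Ω)`
excludes finite invariant sets (`IsDissociated.stabilizer_ne_top`). -/

namespace HoweMoore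

open Topology

/-! ### Permutation representations on `ℓ²(X)`. -/

section PermutationRepresentation

variable {G : Type*} [Group G] {X : Type*} [MulAction G X]

/-- The translate of a square-summable function by a group element. -/
noncomputable def lpTranslate (g : G) :
    lp (fun _ : X => ℂ) 2 →ₗᵢ[ℂ] lp (fun _ : X => ℂ) 2 where
  toFun f := ⟨fun x => f (g⁻¹ • x), by
    have h2 : 0 < (2 : ENNReal).toReal := by norm_num
    have hf := (memℓp_gen_iff h2).1 (lp.memℓp f)
    exact (memℓp_gen_iff h2).2
      ((MulAction.toPerm (g⁻¹ : G) : Equiv.Perm X).summable_iff.2 hf)⟩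
  map_add' _ _ := rfl
  map_smul' _ _ := rfl
  norm_map' f := by
    have h2 : 0 < (2 : ENNReal).toReal := by norm_num
    rw [lp.norm_eq_tsum_rpow h2, lp.norm_eq_tsum_rpow h2]
    exact congrArg (· ^ _) ((MulAction.toPerm (g⁻¹ : G) : Equiv.Perm X).tsum_eq
      fun x => ‖f x‖ ^ (2 : ENNReal).toReal)

@[simp]
theorem lpTranslate_apply (g : G) (f : lp (fun _ : X => ℂ) 2) (x : X) :
    lpTranslate g f x = f (g⁻¹ • x) := rfl

theorem lpTranslate_mul_apply (g h : G) (f : lp (fun _ : X => ℂ) 2) :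
    lpTranslate (g * h) f = lpTranslate g (lpTranslate h f) := by
  ext x
  simp [mul_smul]

theorem lpTranslate_one_apply (f : lp (fun _ : X => ℂ) 2) :
    lpTranslate (1 : G) f = f := by
  ext x
  simp

/-- The permutation representation on square-summable functions, as a homomorphism. -/
noncomputable def lpTranslateHom (G : Type*) [Group G] (X : Type*) [MulAction G X] :
    G →* (lp (fun _ : X => ℂ) 2 ≃ₗᵢ[ℂ] lp (fun _ : X => ℂ) 2) where
  toFun g :=
    { toLinearEquiv := LinearEquiv.ofLinearMap (lpTranslate g).toLinearMap
        (lpTranslate g⁻¹).toLinearMap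
        (by ext1 f; simp [← lpTranslate_mul_apply, lpTranslate_one_apply])
        (by ext1 f; simp [← lpTranslate_mul_apply, lpTranslate_one_apply])
      norm_map' := (lpTranslate g).norm_map }
  map_one' := LinearIsometryEquiv.ext fun f => lpTranslate_one_apply f
  map_mul' g h := LinearIsometryEquiv.ext fun f => lpTranslate_mul_apply g h f

theorem lpTranslate_single [DecidableEq X] (g : G) (x : X) (c : ℂ) :
    lpTranslate g (lp.single 2 x c : lp (fun _ : X => ℂ) 2) = lp.single 2 (g • x) c := by
  ext y
  rw [lpTranslate_apply, lp.single_apply, lp.single_apply, Pi.single_apply, Pi.single_apply]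
  simp only [inv_smul_eq_iff]

/-- Orbit maps of point masses are locally constant because stabilizers are open. Finite
combinations of point masses approximate `f`, uniformly in `g` since translations are isometries. -/
theorem continuous_lpTranslate [TopologicalSpace G] [IsTopologicalGroup G]
    (hX : ∀ x : X, IsOpen (MulAction.stabilizer G x : Set G)) (f : lp (fun _ : X => ℂ) 2) :
    Continuous fun g : G => lpTranslate g f := by
  classical
  have hsingle : ∀ (x : X) (c : ℂ),
      Continuous fun g : G => lpTranslate g (lp.single 2 x c : lp (fun _ : X => ℂ) 2) := by
    intro x c
    refine continuous_iff_continuousAt.2 fun g => ?_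
    refine Filter.EventuallyEq.continuousAt
      (y := lpTranslate g (lp.single 2 x c : lp (fun _ : X => ℂ) 2)) ?_
    have hmem : (fun h : G => g⁻¹ * h) ⁻¹' (MulAction.stabilizer G x : Set G) ∈ 𝓝 g :=
      ((hX x).preimage (continuous_const_mul g⁻¹)).mem_nhds (by simp)
    filter_upwards [hmem] with h hh
    have hx : h • x = g • x := by
      have := MulAction.mem_stabilizer_iff.1 hh
      rwa [mul_smul, inv_smul_eq_iff] at this
    rw [lpTranslate_single, lpTranslate_single, hx]
  have hsum := lp.hasSum_single (E := fun _ : X => ℂ) (p := 2) ENNReal.ofNat_ne_top f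
  refine continuous_of_uniform_approx_of_continuous (f := fun g : G => lpTranslate g f) ?_
  intro u hu
  obtain ⟨ε, hε, hεu⟩ := Metric.mem_uniformity_dist.1 hu
  obtain ⟨s, hs⟩ := (hsum.eventually (Metric.ball_mem_nhds f hε)).exists
  refine ⟨fun g => lpTranslate g (∑ x ∈ s, lp.single 2 x (f x)), ?_, fun g => hεu ?_⟩
  · simp only [map_sum]
    exact continuous_finsetSum _ fun x _ => hsingle x _
  · rw [(lpTranslate g).dist_map, dist_comm]
    exact hs

/-- The permutation representation of a topological group on the square-summable functions on a
set on which it acts with open stabilizers. -/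
noncomputable def permutationRep [TopologicalSpace G] [IsTopologicalGroup G]
    (hX : ∀ x : X, IsOpen (MulAction.stabilizer G x : Set G)) :
    UnitaryRep G (lp (fun _ : X => ℂ) 2) where
  toHom := lpTranslateHom G X
  continuous_orbit := continuous_lpTranslate hX

theorem permutationRep_single [TopologicalSpace G] [IsTopologicalGroup G] [DecidableEq X]
    (hX : ∀ x : X, IsOpen (MulAction.stabilizer G x : Set G)) (g : G) (x : X) (c : ℂ) :
    (permutationRep hX).toHom g (lp.single 2 x c) = lp.single 2 (g • x) c :=
  lpTranslate_single g x c

end PermutationRepresentation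

/-! ### Subrepresentations and almost invariant vectors. -/

namespace UnitaryRep

variable {G : Type*} [Group G] [TopologicalSpace G]
  {H : Type*} [NormedAddCommGroup H] [InnerProductSpace ℂ H] (π : UnitaryRep G H)

theorem toHom_mul_apply (g h : G) (ξ : H) :
    π.toHom (g * h) ξ = π.toHom g (π.toHom h ξ) := by
  rw [map_mul]; rfl

theorem toHom_one_apply (ξ : H) : π.toHom 1 ξ = ξ := by
  rw [map_one]; rfl

theorem toHom_inv_toHom (g : G) (ξ : H) : π.toHom g⁻¹ (π.toHom g ξ) = ξ := by
  rw [← toHom_mul_apply, inv_mul_cancel, toHom_one_apply]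

theorem toHom_toHom_inv (g : G) (ξ : H) : π.toHom g (π.toHom g⁻¹ ξ) = ξ := by
  rw [← toHom_mul_apply, mul_inv_cancel, toHom_one_apply]

/-- The restriction of a unitary representation to an invariant subspace. -/
def restrict (K : Submodule ℂ H) (hK : ∀ g : G, ∀ ξ ∈ K, π.toHom g ξ ∈ K) :
    UnitaryRep G K where
  toHom :=
    { toFun := fun g =>
        { toFun := fun ξ => ⟨π.toHom g ξ, hK g ξ ξ.2⟩
          invFun := fun ξ => ⟨π.toHom g⁻¹ ξ, hK g⁻¹ ξ ξ.2⟩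
          map_add' := fun ξ η => Subtype.ext (map_add (π.toHom g) (ξ : H) η)
          map_smul' := fun c ξ => Subtype.ext (map_smul (π.toHom g) c (ξ : H))
          left_inv := fun ξ => Subtype.ext (π.toHom_inv_toHom g ξ)
          right_inv := fun ξ => Subtype.ext (π.toHom_toHom_inv g ξ)
          norm_map' := fun ξ => (π.toHom g).norm_map ξ }
      map_one' := LinearIsometryEquiv.ext fun ξ => Subtype.ext (π.toHom_one_apply ξ)
      map_mul' := fun g h => LinearIsometryEquiv.ext fun ξ =>
        Subtype.ext (π.toHom_mul_apply g h ξ) }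
  continuous_orbit := fun ξ => (π.continuous_orbit ξ).subtype_mk _

theorem inner_toHom_left (g : G) (ξ η : H) :
    inner ℂ (π.toHom g ξ) η = inner ℂ ξ (π.toHom g⁻¹ η) := by
  rw [← (π.toHom g).inner_map_map ξ, toHom_toHom_inv]

theorem toHom_mem_orthogonal_invariants_top (g : G) (ξ : H) (hξ : ξ ∈ (π.invariants ⊤)ᗮ) :
    π.toHom g ξ ∈ (π.invariants ⊤)ᗮ := by
  rw [Submodule.mem_orthogonal'] at hξ ⊢
  intro η hη
  rw [inner_toHom_left, hη g⁻¹ (Subgroup.mem_top _), hξ η hη]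

/-- A group element carries the vectors fixed by the pointwise stabilizer of `A` to those fixed by
the pointwise stabilizer of the translate of `A`. -/
theorem toHom_mem_invariants_fixingSubgroup_smul {X : Type*} [MulAction G X] {A : Set X} {ξ : H}
    (hξ : ξ ∈ π.invariants (fixingSubgroup G A)) (g : G) :
    π.toHom g ξ ∈ π.invariants (fixingSubgroup G (g • A)) := by
  intro h hh
  have hconj : g⁻¹ * h * g ∈ fixingSubgroup G A := by
    rw [mem_fixingSubgroup_iff] at hh ⊢
    intro a ha
    rw [mul_smul, mul_smul, hh (g • a) (Set.smul_mem_smul_set ha), inv_smul_smul]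
  calc π.toHom h (π.toHom g ξ) = π.toHom g (π.toHom (g⁻¹ * h * g) ξ) := by
        rw [← toHom_mul_apply, ← toHom_mul_apply]; congr 2; group
    _ = π.toHom g ξ := by rw [hξ _ hconj]

/-- A vector that is displaced by at most `ε` by the elements of `K` is at distance at most `ε` of
a `K`-invariant vector. -/
theorem exists_mem_invariants_dist_le [CompleteSpace H] (K : Subgroup G) (ξ : H) (ε : ℝ)
    (hε : ∀ g ∈ K, dist (π.toHom g ξ) ξ ≤ ε) :
    ∃ η ∈ π.invariants K, dist η ξ ≤ ε := by
  let : InnerProductSpace ℝ H := InnerProductSpace.rclikeToReal ℂ H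
  let S : Set H := (fun g : G => π.toHom g ξ) '' K
  let C : Set H := closure (convexHull ℝ S)
  have hS : S.Nonempty := ⟨_, 1, K.one_mem, rfl⟩
  have hCconv : Convex ℝ C := (convex_convexHull ℝ S).closure
  have hCball : C ⊆ Metric.closedBall ξ ε := by
    refine closure_minimal (convexHull_min ?_ (convex_closedBall ξ ε)) Metric.isClosed_closedBall
    rintro _ ⟨g, hg, rfl⟩
    exact hε g hg
  have hCinv : ∀ g ∈ K, ∀ η ∈ C, π.toHom g η ∈ C := by
    intro g hg η hη
    let T : H →L[ℝ] H := ((π.toHom g : H →L[ℂ] H)).restrictScalars ℝ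
    have hT : ∀ ζ, T ζ = π.toHom g ζ := fun _ => rfl
    have hTS : Set.MapsTo T (convexHull ℝ S) (convexHull ℝ S) := by
      rw [Set.mapsTo_iff_image_subset]
      have := (T : H →ₗ[ℝ] H).image_convexHull S
      refine this.subset.trans (convexHull_mono ?_)
      rintro _ ⟨_, ⟨h, hh, rfl⟩, rfl⟩
      exact ⟨g * h, K.mul_mem hg hh, π.toHom_mul_apply g h ξ⟩
    exact (hTS.closure T.continuous) hη
  -- Take the element of least norm in the closed convex hull of the `K`-orbit: `K` preserves the
  -- hull and the norm, so it must fix this element.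
  obtain ⟨η, hηC, hη⟩ := exists_norm_eq_iInf_of_complete_convex
    (hS.convexHull.closure : C.Nonempty) isClosed_closure.isComplete hCconv 0
  have hmin := (norm_eq_iInf_iff_real_inner_le_zero hCconv hηC).1 hη
  refine ⟨η, fun g hg => ?_, hCball hηC⟩
  -- Minimality gives `Re⟨η, gη⟩ ≥ ‖η‖²`; expanding `‖gη - η‖²` then shows it is at most `0`.
  have h1 := hmin _ (hCinv g hg η hηC)
  rw [zero_sub, inner_neg_left, inner_sub_right, real_inner_self_eq_norm_sq] at h1
  have h2 := norm_sub_sq_real (π.toHom g η) η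
  rw [(π.toHom g).norm_map, real_inner_comm] at h2
  have h3 : ‖π.toHom g η - η‖ ^ 2 ≤ 0 := by linarith
  exact sub_eq_zero.1 (norm_eq_zero.1 (pow_eq_zero_iff two_ne_zero |>.1
    (le_antisymm h3 (sq_nonneg _))))

end UnitaryRep

/-! ### Stabilizers: topology, invariant vectors and boundedness. -/

section PermutationGroups

variable {Ω : Type*} {G : Subgroup (Equiv.Perm Ω)}

theorem isOpen_setOf_perm_apply_eq (a b : Ω) : IsOpen {σ : Equiv.Perm Ω | σ a = b} := by
  let : TopologicalSpace Ω := ⊥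
  have : DiscreteTopology Ω := ⟨rfl⟩
  have hcont : Continuous fun (σ : Equiv.Perm Ω) (x : Ω) => σ x := continuous_induced_dom
  exact (isOpen_discrete {b}).preimage ((continuous_apply a).comp hcont)

theorem isOpen_stabilizer (a : Ω) : IsOpen (MulAction.stabilizer G a : Set G) :=
  (isOpen_setOf_perm_apply_eq a a).preimage continuous_subtype_val

theorem isOpen_fixingSubgroup {A : Set Ω} (hA : A.Finite) :
    IsOpen (fixingSubgroup G A : Set G) := by
  have h : (fixingSubgroup G A : Set G) = ⋂ a ∈ A, (MulAction.stabilizer G a : Set G) := by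
    ext g
    simp [mem_fixingSubgroup_iff]
  rw [h]
  exact hA.isOpen_biInter fun a _ => isOpen_stabilizer a

/-- The pointwise stabilizers of finite sets form a neighbourhood basis of the identity. -/
theorem exists_finite_fixingSubgroup_subset {V : Set G} (hV : V ∈ 𝓝 (1 : G)) :
    ∃ A : Set Ω, A.Finite ∧ (fixingSubgroup G A : Set G) ⊆ V := by
  let : TopologicalSpace Ω := ⊥
  have : DiscreteTopology Ω := ⟨rfl⟩
  have hind : IsInducing fun (g : G) (x : Ω) => (g : Equiv.Perm Ω) x :=
    (IsInducing.mk rfl : IsInducing fun (σ : Equiv.Perm Ω) (x : Ω) => σ x).comp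
      IsInducing.subtypeVal
  rw [hind.nhds_eq_comap, Filter.mem_comap] at hV
  obtain ⟨W, hW, hWV⟩ := hV
  rw [nhds_pi, Filter.mem_pi] at hW
  obtain ⟨A, hA, t, ht, htW⟩ := hW
  refine ⟨A, hA, fun g hg => hWV (htW fun a ha => ?_)⟩
  have hga : (g : Equiv.Perm Ω) a = a := (mem_fixingSubgroup_iff G).1 hg a ha
  change (g : Equiv.Perm Ω) a ∈ t a
  rw [hga]
  exact mem_of_mem_nhds (ht a)

theorem fixingSubgroup_le_stabilizer_set (A : Set Ω) :
    fixingSubgroup G A ≤ MulAction.stabilizer G A := by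
  intro g hg
  rw [mem_fixingSubgroup_iff] at hg
  rw [MulAction.mem_stabilizer_iff, ← Set.image_smul]
  exact (Set.image_congr hg).trans (Set.image_id' A)

/-- The vectors fixed by pointwise stabilizers of finite sets are dense. -/
theorem UnitaryRep.exists_mem_invariants_fixingSubgroup_norm_sub_lt {H : Type*}
    [NormedAddCommGroup H] [InnerProductSpace ℂ H] [CompleteSpace H] (π : UnitaryRep G H)
    (ξ : H) {ε : ℝ} (hε : 0 < ε) :
    ∃ A : Set Ω, A.Finite ∧ ∃ η ∈ π.invariants (fixingSubgroup G A), ‖η - ξ‖ < ε := by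
  have hV : {g : G | dist (π.toHom g ξ) ξ < ε / 2} ∈ 𝓝 (1 : G) := by
    have := (π.continuous_orbit ξ).tendsto 1
    rw [π.toHom_one_apply] at this
    exact this (Metric.ball_mem_nhds ξ (half_pos hε))
  obtain ⟨A, hA, hAV⟩ := exists_finite_fixingSubgroup_subset hV
  obtain ⟨η, hη, hd⟩ := π.exists_mem_invariants_dist_le (fixingSubgroup G A) ξ (ε / 2)
    fun g hg => (hAV hg).le
  exact ⟨A, hA, η, hη, by rw [← dist_eq_norm]; linarith⟩

/-- In a dissociated representation without invariant vectors, vectors fixed by the pointwise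
stabilizers of disjoint finite sets are orthogonal. -/
theorem UnitaryRep.IsDissociated.inner_eq_zero_of_disjoint {H : Type*}
    [NormedAddCommGroup H] [InnerProductSpace ℂ H] [CompleteSpace H] {π : UnitaryRep G H}
    (hπ : π.IsDissociated) (hinv : ∀ ξ : H, (∀ g : G, π.toHom g ξ = ξ) → ξ = 0)
    {A B : Set Ω} (hA : A.Finite) (hB : B.Finite) (hAB : Disjoint A B) {ξ η : H}
    (hξ : ξ ∈ π.invariants (fixingSubgroup G A)) (hη : η ∈ π.invariants (fixingSubgroup G B)) :
    inner ℂ ξ η = 0 := by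
  have hproj : (π.invariants (fixingSubgroup G A)).starProjection η = 0 := by
    have h := DFunLike.congr_fun (hπ A B hA hB) η
    rw [ContinuousLinearMap.comp_apply, Submodule.starProjection_eq_self_iff.2 hη] at h
    rw [h]
    -- The projection is onto vectors fixed by the pointwise stabilizer of the empty set, which is
    -- all of `G`.
    refine hinv _ fun g => ?_
    have hmem : (π.invariants (fixingSubgroup G (A ∩ B))).starProjection η ∈
        π.invariants (fixingSubgroup G (A ∩ B)) := Submodule.starProjection_apply_mem _ _
    refine hmem g ?_
    rw [hAB.inter_eq, mem_fixingSubgroup_iff]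
    exact fun y hy => absurd hy (Set.notMem_empty y)
  have h := (π.invariants (fixingSubgroup G A)).starProjection_inner_eq_zero η ξ hξ
  rw [hproj, sub_zero] at h
  exact inner_eq_zero_symm.1 h

/-- This set is either empty or a left coset of `G_a`. -/
theorem isBounded_setOf_smul_eq [Bornology G] (hborn : IsGroupBornology G)
    {a : Ω} (ha : Bornology.IsBounded (MulAction.stabilizer G a : Set G)) (b : Ω) :
    Bornology.IsBounded {g : G | g • a = b} := by
  by_cases h : ∃ k : G, k • a = b
  · obtain ⟨k, rfl⟩ := h
    refine (hborn.mul {k} _ Bornology.isBounded_singleton ha).subset fun g hg => ?_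
    refine Set.mem_mul.2 ⟨k, rfl, k⁻¹ * g, ?_, mul_inv_cancel_left k g⟩
    change (k⁻¹ * g) • a = a
    rw [mul_smul, inv_smul_eq_iff]
    exact hg
  · convert! Bornology.isBounded_empty
    exact Set.eq_empty_of_forall_notMem fun g hg => h ⟨g, hg⟩

theorem isBounded_setOf_not_disjoint_smul [Bornology G] (hborn : IsGroupBornology G)
    (hstab : ∀ a : Ω, Bornology.IsBounded (MulAction.stabilizer G a : Set G))
    {A B : Set Ω} (hA : A.Finite) (hB : B.Finite) :
    Bornology.IsBounded {g : G | ¬ Disjoint (g • A) B} := by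
  have hbdd : Bornology.IsBounded (⋃ a ∈ A, ⋃ b ∈ B, {g : G | g • a = b}) :=
    (Bornology.isBounded_biUnion hA).2 fun a _ =>
      (Bornology.isBounded_biUnion hB).2 fun b _ => isBounded_setOf_smul_eq hborn (hstab a) b
  refine hbdd.subset fun g hg => ?_
  obtain ⟨b, hbA, hbB⟩ := Set.not_disjoint_iff.1 hg
  obtain ⟨a, ha, rfl⟩ := hbA
  exact Set.mem_biUnion ha (Set.mem_biUnion hbB rfl)

end PermutationGroups

/-! ### The main implications. -/

section Equivalence

variable {Ω : Type u} {G : Subgroup (Equiv.Perm Ω)}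

theorem IsDissociated.hasHoweMoore [Bornology G] (hborn : IsGroupBornology G)
    (hdiss : IsDissociated G)
    (hstab : ∀ a : Ω, Bornology.IsBounded (MulAction.stabilizer G a : Set G)) :
    HasHoweMoore G := by
  intro H _ _ _ π hinv ξ η
  refine ⟨(π.continuous_orbit ξ).inner continuous_const, fun ε hε => ?_⟩
  obtain ⟨δ, hδ, hδη⟩ : ∃ δ : ℝ, 0 < δ ∧ δ * ‖η‖ < ε / 2 := by
    refine ⟨ε / 2 / (‖η‖ + 1), by positivity, ?_⟩
    rw [div_mul_eq_mul_div, div_lt_iff₀ (by positivity)]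
    nlinarith
  obtain ⟨A, hA, ξ', hξ', hξξ'⟩ := π.exists_mem_invariants_fixingSubgroup_norm_sub_lt ξ hδ
  -- The tolerance for `η` is chosen after `ξ'`, since its error term carries the factor `‖ξ'‖`.
  obtain ⟨δ', hδ', hδξ⟩ : ∃ δ' : ℝ, 0 < δ' ∧ ‖ξ'‖ * δ' < ε / 2 := by
    refine ⟨ε / 2 / (‖ξ'‖ + 1), by positivity, ?_⟩
    rw [mul_div_assoc', div_lt_iff₀ (by positivity)]
    nlinarith
  obtain ⟨B, hB, η', hη', hηη'⟩ := π.exists_mem_invariants_fixingSubgroup_norm_sub_lt η hδ'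
  refine ⟨_, isBounded_setOf_not_disjoint_smul hborn hstab hA hB, fun g hg => ?_⟩
  have hdisj : Disjoint (g • A) B := not_not.1 hg
  have hzero : inner ℂ (π.toHom g ξ') η' = 0 :=
    (hdiss H π).inner_eq_zero_of_disjoint hinv (hA.smul_set) hB hdisj
      (π.toHom_mem_invariants_fixingSubgroup_smul hξ' g) hη'
  have hsplit : inner ℂ (π.toHom g ξ) η =
      -inner ℂ (π.toHom g (ξ' - ξ)) η - inner ℂ (π.toHom g ξ') (η' - η) := by
    rw [map_sub, inner_sub_left, inner_sub_right, hzero]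
    ring
  have h1 : ‖inner ℂ (π.toHom g (ξ' - ξ)) η‖ ≤ ‖ξ' - ξ‖ * ‖η‖ := by
    simpa only [LinearIsometryEquiv.norm_map] using
      norm_inner_le_norm (𝕜 := ℂ) (π.toHom g (ξ' - ξ)) η
  have h2 : ‖inner ℂ (π.toHom g ξ') (η' - η)‖ ≤ ‖ξ'‖ * ‖η' - η‖ := by
    simpa only [LinearIsometryEquiv.norm_map] using
      norm_inner_le_norm (𝕜 := ℂ) (π.toHom g ξ') (η' - η)
  have h3 : ‖ξ' - ξ‖ * ‖η‖ ≤ δ * ‖η‖ := by gcongr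
  have h4 : ‖ξ'‖ * ‖η' - η‖ ≤ ‖ξ'‖ * δ' := by gcongr
  beta_reduce
  rw [hsplit]
  calc _ ≤ ‖inner ℂ (π.toHom g (ξ' - ξ)) η‖ + ‖inner ℂ (π.toHom g ξ') (η' - η)‖ := by
        simpa only [norm_neg] using norm_sub_le
          (-inner ℂ (π.toHom g (ξ' - ξ)) η) (inner ℂ (π.toHom g ξ') (η' - η))
    _ < ε := by linarith

/-- In a dissociated group without fixed points, no non-empty finite set is invariant. -/
theorem IsDissociated.stabilizer_ne_top [IsTopologicalGroup G] (hdiss : IsDissociated G)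
    (hfix : ∀ a : Ω, ∃ g ∈ G, g a ≠ a) {A : Set Ω} (hA : A.Finite) (hne : A.Nonempty) :
    MulAction.stabilizer G A ≠ ⊤ := by
  classical
  intro htop
  obtain ⟨b, hb⟩ := hne
  obtain ⟨k, hk, hkb⟩ := hfix b
  let g : G := ⟨k, hk⟩
  have hgb : g • b ≠ b := hkb
  let δ : Ω → lp (fun _ : Ω => ℂ) 2 := fun x => lp.single 2 x 1
  let π : UnitaryRep G (lp (fun _ : Ω => ℂ) 2) := permutationRep isOpen_stabilizer
  have hδ : ∀ (h : G) (x : Ω), π.toHom h (δ x) = δ (h • x) := fun h x =>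
    permutationRep_single _ h x 1
  have hδmem : ∀ x, δ x ∈ π.invariants (fixingSubgroup G {x}) := by
    intro x h hh
    rw [hδ, (mem_fixingSubgroup_iff G).1 hh x rfl]
  have hinner : ∀ x y, inner ℂ (δ x) (δ y) = if x = y then (1 : ℂ) else 0 := by
    intro x y
    simp only [δ]
    rw [lp.inner_single_left, lp.single_apply, Pi.single_apply]
    split_ifs <;> simp
  -- The intersection is empty, so `w` is the projection of `δ b` onto the `G`-invariant vectors. It
  -- will vanish, whereas the indicator function of `A` is invariant and not orthogonal to `δ b`.
  set w := (π.invariants (fixingSubgroup G (({g • b} : Set Ω) ∩ {b}))).starProjection (δ b)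
  have hempty : ({g • b} : Set Ω) ∩ {b} = ∅ := by
    rw [Set.singleton_inter_eq_empty]
    exact hgb
  have hmem_empty : ∀ h : G, h ∈ fixingSubgroup G (({g • b} : Set Ω) ∩ {b}) := by
    intro h
    rw [hempty, mem_fixingSubgroup_iff]
    exact fun y hy => absurd hy (Set.notMem_empty y)
  have hwinv : ∀ h : G, π.toHom h w = w := fun h =>
    (Submodule.starProjection_apply_mem _ (δ b) : w ∈ π.invariants _) h (hmem_empty h)
  have hwproj : (π.invariants (fixingSubgroup G {g • b})).starProjection (δ b) = w := by
    have h := DFunLike.congr_fun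
      (hdiss _ π {g • b} {b} (Set.finite_singleton _) (Set.finite_singleton _)) (δ b)
    rwa [ContinuousLinearMap.comp_apply,
      Submodule.starProjection_eq_self_iff.2 (hδmem b)] at h
  -- By dissociation `w` is also the projection of `δ b` onto the vectors fixed by the stabilizer of
  -- `g • b`. As `δ (g • b)` is one of these, its inner products with `w` and `δ b` agree.
  have hwgb : inner ℂ w (δ (g • b)) = 0 := by
    have h := (π.invariants (fixingSubgroup G {g • b})).starProjection_inner_eq_zero (δ b)
      (δ (g • b)) (hδmem _)
    rw [hwproj, inner_sub_left, hinner, if_neg (Ne.symm hgb), zero_sub, neg_eq_zero] at h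
    exact h
  have hwb : inner ℂ w (δ b) = 0 := by
    rw [← (π.toHom g).inner_map_map, hwinv, hδ, hwgb]
  have hortho : ∀ ζ ∈ π.invariants (fixingSubgroup G (({g • b} : Set Ω) ∩ {b})),
      inner ℂ (δ b - w) ζ = 0 :=
    fun ζ hζ => Submodule.starProjection_inner_eq_zero (δ b) ζ hζ
  have hwzero : w = 0 := by
    have h := hortho w (fun h _ => hwinv h)
    rw [inner_sub_left, inner_eq_zero_symm.1 hwb, zero_sub, neg_eq_zero] at h
    exact inner_self_eq_zero.1 h
  have hsuminv : ∑ a ∈ hA.toFinset, δ a ∈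
      π.invariants (fixingSubgroup G (({g • b} : Set Ω) ∩ {b})) := by
    intro h _
    have hh : h • A = A := MulAction.mem_stabilizer_iff.1 (htop ▸ Subgroup.mem_top h)
    rw [map_sum]
    simp only [hδ]
    refine Finset.sum_equiv (MulAction.toPerm h) (fun a => ?_) fun a _ => rfl
    rw [Set.Finite.mem_toFinset, Set.Finite.mem_toFinset, MulAction.toPerm_apply]
    conv_rhs => rw [← hh, Set.smul_mem_smul_set_iff]
  have h := hortho _ hsuminv
  rw [hwzero, sub_zero, inner_sum] at h
  simp only [hinner] at h
  rw [Finset.sum_ite_eq, if_pos (hA.mem_toFinset.2 hb)] at h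
  exact one_ne_zero h

end Equivalence

/-- The Howe–Moore property applies only without invariant vectors, so it is used on their
orthogonal complement in `ℓ²(G/U)`; non-zero invariant vectors exist there when `U` has finite
index. -/
theorem HasHoweMoore.isBounded_of_isOpen {G : Type u} [Group G] [TopologicalSpace G]
    [IsTopologicalGroup G] [Bornology G] (hHM : HasHoweMoore G) (U : Subgroup G)
    (hU : IsOpen (U : Set G)) (hne : U ≠ ⊤) : Bornology.IsBounded (U : Set G) := by
  classical
  have hopen : ∀ x : G ⧸ U, IsOpen (MulAction.stabilizer G x : Set G) := by
    intro x
    induction x using QuotientGroup.induction_on with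
    | H k =>
      have h : (MulAction.stabilizer G (k : G ⧸ U) : Set G) =
          (fun g : G => k⁻¹ * g * k) ⁻¹' (U : Set G) := by
        ext g
        rw [Set.mem_preimage, SetLike.mem_coe, SetLike.mem_coe, MulAction.mem_stabilizer_iff,
          eq_comm, MulAction.Quotient.smul_coe, QuotientGroup.eq, smul_eq_mul, mul_assoc]
      rw [h]
      exact hU.preimage (by fun_prop)
  let π : UnitaryRep G (lp (fun _ : G ⧸ U => ℂ) 2) := permutationRep hopen
  let δ : G ⧸ U → lp (fun _ : G ⧸ U => ℂ) 2 := fun x => lp.single 2 x 1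
  have hδ : ∀ (g : G) (x : G ⧸ U), π.toHom g (δ x) = δ (g • x) := fun g x =>
    permutationRep_single _ g x 1
  let o : G ⧸ U := ((1 : G) : G ⧸ U)
  have ho : ∀ g : G, g • o = o ↔ g ∈ U := by
    intro g
    rw [eq_comm, MulAction.Quotient.smul_coe, QuotientGroup.eq]
    simp
  let p := (π.invariants ⊤).starProjection
  have hpinv : ∀ (g : G) (ξ), π.toHom g (p ξ) = p ξ := fun g ξ =>
    (Submodule.starProjection_apply_mem (π.invariants ⊤) ξ) g (Subgroup.mem_top g)
  let K := (π.invariants ⊤)ᗮ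
  let σ : UnitaryRep G K := π.restrict K π.toHom_mem_orthogonal_invariants_top
  let v : K := ⟨δ o - p (δ o), Submodule.sub_starProjection_mem_orthogonal (δ o)⟩
  have hσ : ∀ ξ : K, (∀ g : G, σ.toHom g ξ = ξ) → ξ = 0 := by
    intro ξ hξ
    have hmem : (ξ : lp (fun _ : G ⧸ U => ℂ) 2) ∈ π.invariants ⊤ := fun g _ =>
      congrArg Subtype.val (hξ g)
    exact Subtype.ext (inner_self_eq_zero.1 ((Submodule.mem_orthogonal _ _).1 ξ.2 _ hmem))
  -- Otherwise the point mass at the base coset would be `G`-invariant, forcing `U = G`.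
  have hvne : v ≠ 0 := by
    intro hv
    have hδo : δ o = p (δ o) := sub_eq_zero.1 (congrArg Subtype.val hv)
    refine hne ((Subgroup.eq_top_iff' U).2 fun g => (ho g).1 ?_)
    by_contra hgo
    have h1 : δ (g • o) = δ o := by rw [← hδ, hδo, hpinv]
    have h2 := congrArg (fun f : lp (fun _ : G ⧸ U => ℂ) 2 => f o) h1
    simp only [δ] at h2
    rw [lp.single_apply_self, lp.single_apply_ne _ _ _ (Ne.symm hgo)] at h2
    exact zero_ne_one h2
  have hvfix : ∀ g ∈ U, σ.toHom g v = v := by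
    intro g hg
    refine Subtype.ext ?_
    change π.toHom g (δ o - p (δ o)) = δ o - p (δ o)
    rw [map_sub, hδ, hpinv, (ho g).2 hg]
  obtain ⟨-, hvanish⟩ := hHM K σ hσ v v
  -- On `U` the coefficient equals `‖v‖ ^ 2`, so with this threshold no element of `U` lies outside
  -- `B`.
  obtain ⟨B, hB, hBlt⟩ := hvanish (‖v‖ ^ 2) (by positivity)
  refine hB.subset fun g hg => ?_
  by_contra hgB
  have h := hBlt g hgB
  beta_reduce at h
  rw [hvfix g hg, inner_self_eq_norm_sq_to_K] at h
  simp at h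

end HoweMoore

theorem mainTheorem2 {Ω : Type u} [Countable Ω] [Infinite Ω]
    (G : Subgroup (Equiv.Perm Ω)) (hclosed : IsClosed (G : Set (Equiv.Perm Ω)))
    (hfix : ∀ a : Ω, ∃ g ∈ G, g a ≠ a)
    [Bornology G] (hborn : HoweMoore.IsTopologicalBornologicalGroup G)
    (hdiss : HoweMoore.IsDissociated G) :
    List.TFAE [
      HoweMoore.HasHoweMoore G,
      ∀ U : Subgroup G, IsOpen (U : Set G) → U ≠ ⊤ → Bornology.IsBounded (U : Set G),
      ∀ A : Set Ω, A.Finite → A.Nonempty →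
        Bornology.IsBounded (MulAction.stabilizer G A : Set G),
      ∀ A : Set Ω, A.Finite → A.Nonempty →
        Bornology.IsBounded (fixingSubgroup G A : Set G),
      ∀ a : Ω, Bornology.IsBounded (MulAction.stabilizer G a : Set G)] := by
  have : IsTopologicalGroup G := hborn.isTopologicalGroup
  tfae_have 1 → 2 := fun h U hU hne => h.isBounded_of_isOpen U hU hne
  tfae_have 2 → 3 := fun h A hA hne =>
    h _ (Subgroup.isOpen_mono (HoweMoore.fixingSubgroup_le_stabilizer_set A)
      (HoweMoore.isOpen_fixingSubgroup hA)) (hdiss.stabilizer_ne_top hfix hA hne)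
  tfae_have 3 → 4 := fun h A hA hne =>
    (h A hA hne).subset (HoweMoore.fixingSubgroup_le_stabilizer_set A)
  tfae_have 4 → 5 := fun h a =>
    (h {a} (Set.finite_singleton a) (Set.singleton_nonempty a)).subset fun g hg =>
      (mem_fixingSubgroup_iff G).2 fun y hy => by
        rw [Set.mem_singleton_iff.1 hy]
        exact hg
  tfae_have 5 → 1 := fun h => hdiss.hasHoweMoore hborn.isGroupBornology h
  tfae_finish
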